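/- Let $p$ be an odd prime, let $\phi,\psi,\zeta_0,\dots,\zeta_{p-1}:\{0,\dots,p-1\}\to\{0,\dots,p-1\}$ be bijections, and for $0\le k<p^2$ put $\eta(k)=\zeta_{\lfloor k/p\rfloor}(k \bmod p)$. Let $H$ be the binary tensor of size $p^2\times p^2\times p^3$ obtained by stacking $p\times p\times p^2$ cyclically shifted identity tensors: for $0\le i,j<p$ and $0\le k<p^2$, the $(i,j,k)$-th block is the $p\times p\times p$ identity tensor (entry $1$ at $(x,y,z)$ iff $x=y=z$) shifted cyclically by $a(i,j,k)=\bigl(\eta(k)+\lfloor k/p\rfloor(\phi(i)+\psi(j))\bigr)\bmod p$ in the positive $x$-direction and by $b(i,j,k)=\bigl(\lfloor k/p\rfloor\,\phi(i)\bigr)\bmod p$ in the positive $y$-direction. The $\ell$-th horizontal layer of $H$ ($0\le \ell<p^3$) is the $p^2\times p^2$ array $H(\cdot,\cdot,\ell)$, and the $m$-th horizontal block-layer ($0\le m<p$) consists of the layers with $\lfloor \ell/p^2\rfloor=m$. Let $w_1,w_2\ge 1$ and choose two disjoint sets of $w_1$ and $w_2$ horizontal block-layers (so $2\le w_1+w_2\le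 p$). Let $H_1$ and $H_2$ be the binary matrices with $p^4$ columns whose rows are the layers in the first and in the second set; they are the parity-check matrices of two classical two-dimensional LDPC codes $\mathcal C_1,\mathcal C_2$ of length $p^4$. Then there is an entanglement-assisted CSS quantum code with one ebit, obtained from $(\mathcal C_1,\mathcal C_2)$ in the following sense. It is the joint $+1$-eigenspace, on $p^4$ channel qubits and the receiver's half of one ebit, of pairwise commuting generators: one $X$-type Pauli operator for every row of $H_1$ and one $Z$-type Pauli operator for every row of $H_2$, whose restrictions to the channel qubits are given by these rows. It has parameters $$[[\,p^4,\; p^4-2p^2-(p^2-1)(w_1+w_2-2)+1;\; 1\,]],$$ that is, with $n$, $k$, $c$ denoting these three numbers, the code space is the set of all states obtained by applying some fixed unitary on the $n$ channel qubits to a state of $k$ message qubits, $n-k-c$ ancillas $|0\rangle$ and the transmitter's halves of $c$ ebits $(|00\rangle+|11\rangle)/\sqrt2$ shared with the receiver, whose halves are untouched. The unassisted part of its Tanner graph, i.e. the bipartite graph between all generators and the $p^4$ channel qubits in which a generator is joined to the qubits on which it acts nontrivially, has girth greater than $4$. In this graph every generator has degree $p^2$ and every qubit has degree $w_1+w_2$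 (low density). -/

import Mathlib

namespace EAQLDPC

/-! ### The parity-check tensor -/

/-- The cyclic predecessor on `{0, …, p - 1}`. -/
def cycPred {p : ℕ} (i : Fin p) : Fin p :=
  ⟨if (i : ℕ) = 0 then p - 1 else (i : ℕ) - 1, by have := i.isLt; split <;> omega⟩

/-- Binary tensors of size `p × p × p`, with local indices `(x, y, z)`. -/
abbrev Cube (p : ℕ) := Fin p → Fin p → Fin p → ZMod 2

/-- The identity tensor. -/
def identityCube (p : ℕ) : Cube p := fun x y z => if x = y ∧ y = z then 1 else 0

/-- One cyclic shift in the positive `x`-direction. -/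
def shiftX {p : ℕ} (T : Cube p) : Cube p := fun x y z => T (cycPred x) y z

/-- One cyclic shift in the positive `y`-direction. -/
def shiftY {p : ℕ} (T : Cube p) : Cube p := fun x y z => T x (cycPred y) z

/-- The map `η`: on the `m`-th run of `p` consecutive values of `k` it is
`k ↦ ζ m (k mod p)`. -/
def eta {p : ℕ} (ζ : Fin p → Fin p → Fin p) (k : Fin (p * p)) : Fin p :=
  ζ k.divNat k.modNat

/-- The `X`-shift `a(i, j, k)`. -/
def xShift {p : ℕ} (φ ψ : Fin p → Fin p) (ζ : Fin p → Fin p → Fin p)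
    (i j : Fin p) (k : Fin (p * p)) : ℕ :=
  ((eta ζ k : ℕ) + (k : ℕ) / p * ((φ i : ℕ) + (ψ j : ℕ))) % p

/-- The `Y`-shift `b(i, j, k)`. -/
def yShift {p : ℕ} (φ : Fin p → Fin p) (i : Fin p) (k : Fin (p * p)) : ℕ :=
  ((k : ℕ) / p * (φ i : ℕ)) % p

/-- The parity-check tensor: the stack of `p × p × p²` shifted identity tensors. The global
position `(X, Y, ℓ)` lies in the tensor `(i, j, k) = (⌊X/p⌋, ⌊Y/p⌋, ⌊ℓ/p⌋)` and has there the
local indices `(X mod p, Y mod p, ℓ mod p)`. -/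
def parityTensor {p : ℕ} (φ ψ : Fin p → Fin p) (ζ : Fin p → Fin p → Fin p)
    (X Y : Fin (p * p)) (l : Fin (p * p * p)) : ZMod 2 :=
  (shiftX^[xShift φ ψ ζ X.divNat Y.divNat l.divNat]
    (shiftY^[yShift φ X.divNat l.divNat] (identityCube p))) X.modNat Y.modNat l.modNat

/-- The index `⌊ℓ / p²⌋` of the horizontal block-layer that contains the horizontal layer `ℓ`. -/
def blockLayer {p : ℕ} (l : Fin (p * p * p)) : Fin p := l.divNat.divNat

/-- The horizontal layers contained in the horizontal block-layers in `B`. -/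
abbrev Layers {p : ℕ} (B : Finset (Fin p)) := {l : Fin (p * p * p) // blockLayer l ∈ B}

/-- The parity-check matrix of the two-dimensional classical code whose parity-check tensor
consists of the horizontal block-layers in `B`: one row per horizontal layer, one column per
position of the `p² × p²` array. -/
def parityMatrix {p : ℕ} (φ ψ : Fin p → Fin p) (ζ : Fin p → Fin p → Fin p)
    (B : Finset (Fin p)) : Matrix (Layers B) (Fin (p * p) × Fin (p * p)) (ZMod 2) :=
  fun l XY => parityTensor φ ψ ζ XY.1 XY.2 l.1

/-! ### Entanglement-assisted quantum codes -/

/-- State vectors, in the computational basis, of the qubits `A` that are sent through the channel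
together with the receiver's halves `B` of the ebits. -/
abbrev State (A B : Type*) := (A → ZMod 2) × (B → ZMod 2) → ℂ

/-- The Pauli operator `X^u ⊗ X^u'`. -/
def pauliX {A B : Type*} (u : A → ZMod 2) (u' : B → ZMod 2) : State A B →ₗ[ℂ] State A B where
  toFun f := fun s => f (s.1 + u, s.2 + u')
  map_add' _ _ := rfl
  map_smul' _ _ := rfl

/-- The Pauli operator `Z^v ⊗ Z^v'`. -/
def pauliZ {A B : Type*} [Fintype A] [Fintype B] (v : A → ZMod 2) (v' : B → ZMod 2) :
    State A B →ₗ[ℂ] State A B where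
  toFun f := fun s => (-1 : ℂ) ^ (v ⬝ᵥ s.1 + v' ⬝ᵥ s.2).val * f s
  map_add' f g := by funext s; simp [mul_add]
  map_smul' r f := by funext s; simp [mul_left_comm]

/-- Identify the transmitter's qubits with `k` message qubits, `s` ancillas and `c` halves of
ebits. This map sends a message `ξ` to `|ξ⟩ ⊗ |0⟩^{⊗ s} ⊗ |Φ⁺⟩^{⊗ c}`, where
`|Φ⁺⟩ = (|00⟩ + |11⟩) / √2` is shared between transmitter and receiver. -/
noncomputable def prepare {A : Type*} {k s c : ℕ} (e : A ≃ Fin k ⊕ Fin s ⊕ Fin c) :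
    ((Fin k → ZMod 2) → ℂ) →ₗ[ℂ] State A (Fin c) where
  toFun ξ := fun t =>
    if (∀ i : Fin s, t.1 (e.symm (.inr (.inl i))) = 0) ∧
        (∀ j : Fin c, t.1 (e.symm (.inr (.inr j))) = t.2 j) then
      (((Real.sqrt 2 : ℝ) : ℂ) ^ c)⁻¹ * ξ (fun i => t.1 (e.symm (.inl i)))
    else 0
  map_add' f g := by funext t; by_cases h : (∀ i : Fin s, t.1 (e.symm (.inr (.inl i))) = 0) ∧
        (∀ j : Fin c, t.1 (e.symm (.inr (.inr j))) = t.2 j) <;> simp [h, mul_add]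
  map_smul' r f := by funext t; by_cases h : (∀ i : Fin s, t.1 (e.symm (.inr (.inl i))) = 0) ∧
        (∀ j : Fin c, t.1 (e.symm (.inr (.inr j))) = t.2 j) <;> simp [h, mul_left_comm]

/-- The operator `U ⊗ 1`, where `U` acts on the transmitter's qubits only. -/
def onTransmitter {A B : Type*} [Fintype A] [DecidableEq A]
    (U : Matrix (A → ZMod 2) (A → ZMod 2) ℂ) : State A B →ₗ[ℂ] State A B where
  toFun f := fun t => ∑ a, U t.1 a * f (a, t.2)
  map_add' f g := by funext t; simp [mul_add, Finset.sum_add_distrib]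
  map_smul' r f := by funext t; simp [Finset.mul_sum, mul_left_comm]

/-- `Q` is an entanglement-assisted quantum code with parameters `[[n, k; c]]`: the `n` channel
qubits are obtained by applying a unitary on the transmitter's side to `k` message qubits,
`n - k - c` ancillas in the state `|0⟩` and the transmitter's halves of `c` ebits; the receiver's
halves are left untouched. -/
def IsEACode {A : Type*} [Fintype A] [DecidableEq A] (n k c : ℕ)
    (Q : Submodule ℂ (State A (Fin c))) : Prop :=
  Fintype.card A = n ∧
  ∃ (s : ℕ) (e : A ≃ Fin k ⊕ Fin s ⊕ Fin c),
    ∃ U ∈ Matrix.unitaryGroup (A → ZMod 2) ℂ,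
      Q = LinearMap.range (onTransmitter U ∘ₗ prepare e)

/-- Stabilizer data of an entanglement-assisted CSS code with `c` ebits: a family of `X`-type and
a family of `Z`-type generators, each given by its part on the channel qubits (`xCheck`, `zCheck`)
and its part on the receiver's halves of the ebits (`xEbit`, `zEbit`). All of them commute. -/
structure EACSS (R₁ R₂ A : Type*) [Fintype A] (c : ℕ) where
  xCheck : Matrix R₁ A (ZMod 2)
  zCheck : Matrix R₂ A (ZMod 2)
  xEbit : Matrix R₁ (Fin c) (ZMod 2)
  zEbit : Matrix R₂ (Fin c) (ZMod 2)
  commute : xCheck * zCheck.transpose + xEbit * zEbit.transpose = 0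

/-- The bipartite graph of a binary check matrix: rows are check nodes, columns are variable
nodes. -/
def tannerGraph {R V : Type*} (M : Matrix R V (ZMod 2)) : SimpleGraph (R ⊕ V) :=
  SimpleGraph.fromRel fun s t => ∃ r v, s = .inl r ∧ t = .inr v ∧ M r v ≠ 0

namespace EACSS

variable {R₁ R₂ A : Type*} [Fintype A] {c : ℕ}

/-- The code space: the joint `+1`-eigenspace of all the generators. -/
def codeSpace (S : EACSS R₁ R₂ A c) : Submodule ℂ (State A (Fin c)) :=
  (⨅ r, LinearMap.eqLocus (pauliX (S.xCheck r) (S.xEbit r)) LinearMap.id) ⊓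
    ⨅ r, LinearMap.eqLocus (pauliZ (S.zCheck r) (S.zEbit r)) LinearMap.id

/-- The overall Tanner graph: the check nodes are all the generators, the variable nodes are the
channel qubits and the receiver's halves of the ebits, and a generator is joined to the qubits on
which it acts nontrivially. -/
def overallTannerGraph (S : EACSS R₁ R₂ A c) : SimpleGraph ((R₁ ⊕ R₂) ⊕ (A ⊕ Fin c)) :=
  tannerGraph (Matrix.fromBlocks S.xCheck S.xEbit S.zCheck S.zEbit)

/-- The unassisted portion of the overall Tanner graph: the subgraph induced on all the check
nodes and the channel qubits, without the ebits. -/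
def unassistedTannerGraph (S : EACSS R₁ R₂ A c) : SimpleGraph ((R₁ ⊕ R₂) ⊕ A) :=
  S.overallTannerGraph.comap (Sum.map id Sum.inl)

end EACSS

end EAQLDPC

/-!
Write `F = ZMod p`. In the coordinates `f = φ i`, `y`, `g = ψ j`, `u = x - y` for the position
`(i p + x, j p + y)` and `m`, `s = ζ m t`, `z` for the layer `(m p + t) p + z`, the parity-check
tensor has a `1` exactly when `y = z + m f` and `u = s + m g` (`parityTensor_eq`). A layer is thus a
product of two lines of the same slope `m` in `F² × F²`. Layers of the same slope partition the
positions, layers of different slopes meet in exactly one position, and a layer has `p²` positions.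
This gives the degrees, and since no two layers share two positions the Tanner graph has no
`4`-cycle.

Because `p` is odd, these intersection numbers determine the Gram matrix of the rows over `𝔽₂`:
the identity within a block-layer, all ones between different ones. Hence `H₁ H₂ᵀ` is the
all-ones matrix, and the generators commute once each of them also acts on the single ebit. The
same Gram matrix yields the ranks (`IsResolved`): it acts as the identity on the coefficient vectors
whose sum over each block-layer vanishes, so these are mapped injectively, onto the span `E` of the
even sums of rows of `H₁`; and the image of `H₂` is spanned by such vectors and the all-ones
vector. So `dim E = w₁ (p² - 1)` and `K = ker H₂` has dimension `p⁴ - w₂ (p² - 1) - 1`.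

Finally, `E ≤ K`, and the code space is identified with the functions on `K / E`, hence
`k = dim K - dim E`. The encoding unitary is obtained by extending the orthonormal family of coset
states of `E` to an orthonormal basis (`isEACode_codeSpace`).
-/

namespace EAQLDPC

open Matrix

/-! ### One-ebit CSS codes whose generators all act on the ebit -/

section Quantum

/-- The sums of an even number of rows of `M`. -/
def evenRowSpace {R A : Type*} [Fintype R] (M : Matrix R A (ZMod 2)) :
    Submodule (ZMod 2) (A → ZMod 2) :=
  (LinearMap.ker (∑ r, LinearMap.proj r : (R → ZMod 2) →ₗ[ZMod 2] ZMod 2)).map M.vecMulLinear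

theorem mem_evenRowSpace {R A : Type*} [Fintype R] {M : Matrix R A (ZMod 2)} {x : A → ZMod 2} :
    x ∈ evenRowSpace M ↔ ∃ v : R → ZMod 2, ∑ r, v r = 0 ∧ v ᵥ* M = x := by
  simp [evenRowSpace]

theorem sub_mem_evenRowSpace {R A : Type*} [Fintype R] (M : Matrix R A (ZMod 2)) (r r' : R) :
    M r - M r' ∈ evenRowSpace M := by
  classical
  refine mem_evenRowSpace.2 ⟨Pi.single r 1 - Pi.single r' 1, by simp, ?_⟩
  rw [sub_vecMul, single_one_vecMul, single_one_vecMul]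
  rfl

variable {R₁ R₂ A : Type*} [Fintype A] {c : ℕ}

theorem mem_codeSpace_iff (S : EACSS R₁ R₂ A c) (f : State A (Fin c)) :
    f ∈ S.codeSpace ↔
      (∀ r a b, f (a + S.xCheck r, b + S.xEbit r) = f (a, b)) ∧
        ∀ r a b, S.zCheck r ⬝ᵥ a + S.zEbit r ⬝ᵥ b ≠ 0 → f (a, b) = 0 := by
  have key : ∀ (x : ZMod 2) (y : ℂ), (-1 : ℂ) ^ x.val * y = y ↔ (x ≠ 0 → y = 0) := by
    intro x y
    have hx : x = 0 ∨ x = 1 := by revert x; decide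
    rcases hx with rfl | rfl
    · simp
    · have : (1 : ZMod 2).val = 1 := rfl
      simp only [this, pow_one, neg_mul, one_mul, ne_eq, one_ne_zero, not_false_eq_true,
        forall_const]
      exact neg_eq_self
  simp only [EACSS.codeSpace, Submodule.mem_inf, Submodule.mem_iInf, LinearMap.mem_eqLocus,
    LinearMap.id_apply, pauliX, pauliZ, LinearMap.coe_mk, AddHom.coe_mk, funext_iff, Prod.forall,
    key]

theorem codeSpace_apply_add_vecMul [Fintype R₁] (S : EACSS R₁ R₂ A c) {f : State A (Fin c)}
    (hf : f ∈ S.codeSpace) (v : R₁ → ZMod 2) (a : A → ZMod 2) (b : Fin c → ZMod 2) :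
    f (a + v ᵥ* S.xCheck, b + v ᵥ* S.xEbit) = f (a, b) := by
  classical
  have hX := ((mem_codeSpace_iff S f).1 hf).1
  rw [vecMul_eq_sum, vecMul_eq_sum]
  induction (Finset.univ : Finset R₁) using Finset.induction_on with
  | empty => simp
  | insert r s hr ih =>
    rw [Finset.sum_insert hr, Finset.sum_insert hr]
    have hv : ∀ x : ZMod 2, x = 0 ∨ x = 1 := by decide
    rcases hv (v r) with h | h
    · simpa [h] using ih
    · rw [h, one_smul, one_smul, add_comm (S.xCheck r), add_comm (S.xEbit r), ← add_assoc,
        ← add_assoc, hX, ih]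

/-- Representatives for the cosets of a subspace, indexed by a coordinate space of the right
dimension. -/
theorem exists_coset_representatives {V : Type*} [AddCommGroup V] [Module (ZMod 2) V]
    [FiniteDimensional (ZMod 2) V] {E K : Submodule (ZMod 2) V} (hEK : E ≤ K) {k : ℕ}
    (hk : Module.finrank (ZMod 2) E + k = Module.finrank (ZMod 2) K) :
    ∃ rep : (Fin k → ZMod 2) → V, (∀ μ, rep μ ∈ K) ∧
      (∀ μ μ', rep μ - rep μ' ∈ E → μ = μ') ∧ ∀ x ∈ K, ∃ μ, x - rep μ ∈ E := by
  have h1 := Submodule.finrank_quotient_add_finrank (E.submoduleOf K)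
  rw [(Submodule.submoduleOfEquivOfLe hEK).finrank_eq] at h1
  have h2 : Module.finrank (ZMod 2) (Fin k → ZMod 2) =
      Module.finrank (ZMod 2) (K ⧸ E.submoduleOf K) := by
    rw [Module.finrank_fin_fun]; omega
  let g := LinearEquiv.ofFinrankEq _ _ h2
  have hout : ∀ μ, Submodule.Quotient.mk (g μ).out = g μ := fun μ => Quotient.out_eq _
  refine ⟨fun μ => ((g μ).out : K), fun μ => SetLike.coe_mem _, fun μ μ' h => ?_, fun x hx => ?_⟩
  · apply g.injective
    rw [← hout μ, ← hout μ', Submodule.Quotient.eq]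
    exact h
  · refine ⟨g.symm (Submodule.Quotient.mk ⟨x, hx⟩), ?_⟩
    have : (Submodule.Quotient.mk ⟨x, hx⟩ : K ⧸ E.submoduleOf K) =
        Submodule.Quotient.mk (g (g.symm (Submodule.Quotient.mk ⟨x, hx⟩))).out := by
      rw [hout, g.apply_symm_apply]
    have hmem := (Submodule.Quotient.eq _).1 this
    exact hmem

open Classical in
/-- The normalized superposition of the elements of the coset `x + E`. -/
noncomputable def cosetState {V : Type*} [AddCommGroup V] [Module (ZMod 2) V]
    (E : Submodule (ZMod 2) V) (x : V) : EuclideanSpace ℂ V :=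
  WithLp.toLp 2 fun a => if a - x ∈ E then ((Real.sqrt (Nat.card E) : ℝ) : ℂ)⁻¹ else 0

theorem inner_cosetState_self {V : Type*} [AddCommGroup V] [Module (ZMod 2) V] [Fintype V]
    (E : Submodule (ZMod 2) V) (x : V) :
    inner ℂ (cosetState E x) (cosetState E x) = 1 := by
  classical
  have hcard : (Finset.univ.filter fun a => a - x ∈ E).card = Nat.card E := by
    rw [Nat.card_eq_fintype_card, ← Finset.card_univ]
    refine Finset.card_bij' (fun a h => ⟨a - x, by simpa using h⟩) (fun a _ => a + x) ?_ ?_ ?_ ?_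
    all_goals simp
  have hpos : (0 : ℝ) < Nat.card E := by exact_mod_cast Nat.card_pos
  have hsq : ((Real.sqrt (Nat.card E) : ℝ) : ℂ) * ((Real.sqrt (Nat.card E) : ℝ) : ℂ)
      = (Nat.card E : ℂ) := by
    rw [← Complex.ofReal_mul, Real.mul_self_sqrt hpos.le]; simp
  have hne : (Nat.card E : ℂ) ≠ 0 := by exact_mod_cast hpos.ne'
  rw [PiLp.inner_apply]
  calc _ = ∑ a : V, if a - x ∈ E then (Nat.card E : ℂ)⁻¹ else 0 := by
        refine Finset.sum_congr rfl fun a _ => ?_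
        by_cases h : a - x ∈ E
        · simp only [cosetState, h, if_true, RCLike.inner_apply, map_inv₀, Complex.conj_ofReal,
            ← mul_inv, hsq]
        · simp [cosetState, h]
    _ = 1 := by
        rw [← Finset.sum_filter, Finset.sum_const, hcard, nsmul_eq_mul, mul_inv_cancel₀ hne]

theorem inner_cosetState_of_sub_notMem {V : Type*} [AddCommGroup V] [Module (ZMod 2) V]
    [Fintype V] (E : Submodule (ZMod 2) V) {x y : V} (h : x - y ∉ E) :
    inner ℂ (cosetState E x) (cosetState E y) = 0 := by
  rw [PiLp.inner_apply]
  refine Finset.sum_eq_zero fun a _ => ?_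
  by_cases hx : a - x ∈ E
  · have hy : a - y ∉ E := fun hy => h (by simpa using E.sub_mem hy hx)
    simp [cosetState, hy]
  · simp [cosetState, hx]

/-- Vectors that are orthonormal along part of an index set of the right size are columns of a
unitary matrix. -/
theorem exists_unitary_of_orthonormal {ι : Type*} [Fintype ι] [DecidableEq ι]
    (v : ι → EuclideanSpace ℂ ι) (s : Set ι) (hv : Orthonormal ℂ (s.domRestrict v)) :
    ∃ U ∈ Matrix.unitaryGroup ι ℂ, ∀ t ∈ s, ∀ a, U a t = v t a := by
  obtain ⟨b, hb⟩ := hv.exists_orthonormalBasis_extension_of_card_eq (by simp)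
  refine ⟨(EuclideanSpace.basisFun ι ℂ).toBasis.toMatrix b,
    OrthonormalBasis.toMatrix_orthonormalBasis_mem_unitary _ _, fun t ht a => ?_⟩
  rw [← hb t ht]
  simp [Module.Basis.toMatrix_apply]

theorem evenRowSpace_le_ker [Fintype R₁] (S : EACSS R₁ R₂ A 1) (hx : ∀ r j, S.xEbit r j = 1) :
    evenRowSpace S.xCheck ≤ LinearMap.ker S.zCheck.mulVecLin := by
  intro x h
  obtain ⟨v, hv, rfl⟩ := mem_evenRowSpace.1 h
  have h0 : v ᵥ* S.xEbit = 0 := by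
    funext j
    simp [vecMul, dotProduct, hx, hv]
  have h1 := congrArg (v ᵥ* ·) S.commute
  simp only [vecMul_add, ← vecMul_vecMul, h0, zero_vecMul, add_zero, vecMul_zero] at h1
  rw [vecMul_transpose] at h1
  simpa using h1

theorem zCheck_mulVec_xCheck (S : EACSS R₁ R₂ A 1) (hx : ∀ r j, S.xEbit r j = 1)
    (hz : ∀ r j, S.zEbit r j = 1) (r : R₁) (r' : R₂) : S.zCheck r' ⬝ᵥ S.xCheck r = 1 := by
  have h := congrFun (congrFun S.commute r) r'
  simp only [Matrix.add_apply, mul_apply, transpose_apply, hx, hz, Finset.univ_unique,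
    Finset.sum_const, Finset.card_singleton, one_smul, mul_one, Matrix.zero_apply] at h
  rw [dotProduct_comm]
  have key : ∀ x : ZMod 2, x + 1 = 0 → x = 1 := by decide
  exact key _ h

/-- The dimension formula for one-ebit codes in which every generator acts on the ebit. If `h` is
a row of the `X`-checks, a code state is determined by its values at `(a, 0)`; it vanishes there
unless `a` is in the kernel `K` of the `Z`-checks, is constant on the cosets of the even row space
`E` of the `X`-checks, and is carried to the points `(a, 1)` by translation by `h`. So the
encoding unitary sends the basis states of message and ebit to the coset states of
`rep μ + β h + E`, where `rep` runs through representatives of `K / E`. -/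
theorem isEACode_codeSpace [Fintype R₁] [DecidableEq A] [Nonempty R₁] [Nonempty R₂]
    (S : EACSS R₁ R₂ A 1)
    (hx : ∀ r j, S.xEbit r j = 1) (hz : ∀ r j, S.zEbit r j = 1) {k : ℕ}
    (hk : Module.finrank (ZMod 2) (evenRowSpace S.xCheck) + k =
      Module.finrank (ZMod 2) (LinearMap.ker S.zCheck.mulVecLin)) :
    IsEACode (Fintype.card A) k 1 S.codeSpace := by
  classical
  obtain ⟨r₁⟩ := ‹Nonempty R₁›
  obtain ⟨r₂⟩ := ‹Nonempty R₂›
  set E := evenRowSpace S.xCheck with hE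
  set K := LinearMap.ker S.zCheck.mulVecLin with hK
  have hEK : E ≤ K := evenRowSpace_le_ker S hx
  set h := S.xCheck r₁ with hh
  have hzh : ∀ r, S.zCheck r ⬝ᵥ h = 1 := zCheck_mulVec_xCheck S hx hz r₁
  have memK : ∀ a, a ∈ K ↔ ∀ r, S.zCheck r ⬝ᵥ a = 0 := fun a => by
    simp [hK, funext_iff, mulVec]
  have hhK : h ∉ K := fun hc => by
    have := (memK h).1 hc r₂
    rw [hzh] at this
    exact one_ne_zero this
  -- `K` is a proper subspace, which leaves a qubit for the ebit.
  have hkn : k + 1 ≤ Fintype.card A := by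
    have : Module.finrank (ZMod 2) K < Module.finrank (ZMod 2) (A → ZMod 2) :=
      Submodule.finrank_lt (fun ht => hhK (ht ▸ Submodule.mem_top))
    rw [Module.finrank_fintype_fun_eq_card] at this
    omega
  obtain ⟨rep, hrepK, hrep_inj, hrep_surj⟩ := exists_coset_representatives hEK hk
  have e : A ≃ Fin k ⊕ Fin (Fintype.card A - k - 1) ⊕ Fin 1 :=
    Fintype.equivOfCardEq (by simp; omega)
  refine ⟨rfl, Fintype.card A - k - 1, e, ?_⟩
  -- `msg` and `bit` read off the message and the ebit of a basis state.
  let msg : (A → ZMod 2) → Fin k → ZMod 2 := fun t i => t (e.symm (.inl i))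
  let bit : (A → ZMod 2) → ZMod 2 := fun t => t (e.symm (.inr (.inr 0)))
  let s : Set (A → ZMod 2) := {t | ∀ i, t (e.symm (.inr (.inl i))) = 0}
  have hs_ext : ∀ t ∈ s, ∀ t' ∈ s, msg t = msg t' → bit t = bit t' → t = t' := by
    intro t ht t' ht' hm hb
    funext i
    obtain ⟨j, rfl⟩ := e.symm.surjective i
    rcases j with j | j | j
    · exact congrFun hm j
    · rw [ht, ht']
    · rw [Subsingleton.elim j 0]; exact hb
  obtain ⟨U, hU, hUv⟩ := exists_unitary_of_orthonormal
    (fun t => cosetState E (rep (msg t) + bit t • h)) s <| by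
    rw [orthonormal_iff_ite]
    rintro ⟨t, ht⟩ ⟨t', ht'⟩
    split_ifs with heq
    · obtain rfl : t = t' := congrArg Subtype.val heq
      exact inner_cosetState_self _ _
    · refine inner_cosetState_of_sub_notMem _ fun hmem => heq (Subtype.ext ?_)
      have hbit : bit t = bit t' := by
        have h1 := (memK _).1 (hEK hmem) r₂
        have h2 := (memK _).1 (hrepK (msg t)) r₂
        have h3 := (memK _).1 (hrepK (msg t')) r₂
        simp only [dotProduct_sub, dotProduct_add, dotProduct_smul, h2, h3, hzh, smul_eq_mul,
          mul_one, zero_add] at h1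
        exact sub_eq_zero.1 h1
      refine hs_ext t ht t' ht' (hrep_inj _ _ ?_) hbit
      simpa [hbit] using hmem
  refine ⟨U, hU, ?_⟩
  -- The constant `κ` collects the normalizations of the coset states and of the ebit.
  obtain ⟨κ, hκ, henc⟩ : ∃ κ : ℂ, κ ≠ 0 ∧ ∀ (ξ : (Fin k → ZMod 2) → ℂ) (a : A → ZMod 2)
      (b : Fin 1 → ZMod 2), (onTransmitter U ∘ₗ prepare e) ξ (a, b) =
        ∑ μ, if a - (rep μ + b 0 • h) ∈ E then κ * ξ μ else 0 := by
    refine ⟨((Real.sqrt (Nat.card E) : ℝ) : ℂ)⁻¹ * (((Real.sqrt 2 : ℝ) : ℂ) ^ 1)⁻¹, ?_, ?_⟩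
    · have h1 : Real.sqrt (Nat.card E) ≠ 0 :=
        (Real.sqrt_pos.2 (by exact_mod_cast Nat.card_pos)).ne'
      have h2 : Real.sqrt 2 ≠ 0 := by positivity
      refine mul_ne_zero (inv_ne_zero (by exact_mod_cast h1)) (inv_ne_zero ?_)
      rw [pow_one]
      exact_mod_cast h2
    · intro ξ a b
      -- The only inputs that contribute have ancillas `0` and the ebit equal to `b`.
      let lift : (Fin k → ZMod 2) → A → ZMod 2 :=
        fun μ i => Sum.elim μ (Sum.elim (fun _ => 0) b) (e i)
      have hl_inj : Function.Injective lift := fun μ μ' hμ => by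
        funext i
        have := congrFun hμ (e.symm (.inl i))
        simpa [lift] using this
      have hl_s : ∀ μ, lift μ ∈ s := fun μ i => by simp [lift]
      have hl_msg : ∀ μ, msg (lift μ) = μ := fun μ => by funext i; simp [lift, msg]
      have hl_bit : ∀ μ, bit (lift μ) = b 0 := fun μ => by simp [lift, bit]
      simp only [LinearMap.comp_apply, onTransmitter, prepare, LinearMap.coe_mk, AddHom.coe_mk]
      symm
      refine Finset.sum_of_injOn lift hl_inj.injOn (fun _ _ => Finset.mem_coe.2 (Finset.mem_univ _))
        ?_ ?_
      · intro t _ ht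
        rw [if_neg, mul_zero]
        rintro ⟨h1, h2⟩
        refine ht ⟨msg t, by simp, hs_ext _ (hl_s _) _ h1 (hl_msg _) ?_⟩
        rw [hl_bit, ← h2 0]
      · intro μ _
        rw [hUv _ (hl_s μ), if_pos (c := (∀ i, lift μ (e.symm (.inr (.inl i))) = 0) ∧
          ∀ j, lift μ (e.symm (.inr (.inr j))) = b j) ⟨hl_s μ, fun j => by simp [lift]⟩]
        have := hl_msg μ
        simp only [msg] at this
        simp only [cosetState, hl_msg, hl_bit, this]
        split_ifs <;> ring
  have hxE : ∀ r, S.xEbit r = 1 := fun r => funext fun j => hx r j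
  have hdot : ∀ r (b : Fin 1 → ZMod 2), S.zEbit r ⬝ᵥ b = b 0 := fun r b => by
    simp [dotProduct, hz]
  have two : ∀ x : ZMod 2, x + x = 0 := by decide
  ext f
  constructor
  · intro hf
    have hf' := hf
    rw [mem_codeSpace_iff] at hf'
    obtain ⟨-, hZ⟩ := hf'
    -- Translation by even row sums, and by `h` together with a flip of the ebit.
    have hinv : ∀ x ∈ E, ∀ a b, f (a + x + b 0 • h, b) = f (a, 0) := by
      intro x hxE' a b
      obtain ⟨v, hv, rfl⟩ := mem_evenRowSpace.1 hxE'
      have := codeSpace_apply_add_vecMul S hf (v + b 0 • Pi.single r₁ 1) a 0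
      rw [add_vecMul, add_vecMul, smul_vecMul, smul_vecMul, single_one_vecMul,
        single_one_vecMul] at this
      rw [← this]
      congr 2
      · rw [add_assoc]; rfl
      · funext j
        rw [Subsingleton.elim j 0]
        simp [vecMul, dotProduct, hx, hv]
    refine ⟨fun μ => κ⁻¹ * f (rep μ, 0), ?_⟩
    funext ⟨a, b⟩
    rw [henc]
    simp only [mul_inv_cancel_left₀ hκ]
    -- Outside `K + b 0 • h` some `Z`-type generator acts on `(a, b)` with the sign `-1`.
    by_cases ha : a - b 0 • h ∈ K
    · obtain ⟨μ, hμ⟩ := hrep_surj _ ha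
      rw [Finset.sum_eq_single μ, if_pos (by rwa [sub_sub, add_comm] at hμ)]
      · rw [← hinv _ hμ (rep μ) b]
        congr 2
        abel
      · intro μ' _ hne
        rw [if_neg]
        intro hμ'
        apply hne
        apply hrep_inj
        have := E.sub_mem hμ hμ'
        convert this using 1
        abel
      · simp
    · rw [memK] at ha
      push Not at ha
      obtain ⟨r, hr⟩ := ha
      rw [hZ r a b, Finset.sum_eq_zero]
      · intro μ _
        rw [if_neg]
        intro hμ
        have h1 := (memK _).1 (hEK hμ) r
        have h2 := (memK _).1 (hrepK μ) r
        apply hr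
        rw [dotProduct_sub, dotProduct_add, h2, zero_add] at h1
        rw [dotProduct_sub, h1]
      · rw [hdot]
        rw [dotProduct_sub, dotProduct_smul, hzh, smul_eq_mul, mul_one, sub_eq_add_neg,
          ZMod.neg_eq_self_mod_two] at hr
        exact hr
  · rintro ⟨ξ, rfl⟩
    rw [mem_codeSpace_iff]
    refine ⟨fun r a b => ?_, fun r a b hr => ?_⟩
    · rw [henc, henc]
      refine Finset.sum_congr rfl fun μ _ => ?_
      have : a + S.xCheck r - (rep μ + (b + S.xEbit r) 0 • h) ∈ E ↔
          a - (rep μ + b 0 • h) ∈ E := by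
        have hd := sub_mem_evenRowSpace S.xCheck r r₁
        have heq : a + S.xCheck r - (rep μ + (b + S.xEbit r) 0 • h) =
            a - (rep μ + b 0 • h) + (S.xCheck r - S.xCheck r₁) := by
          rw [hxE, Pi.add_apply, Pi.one_apply, add_smul, one_smul, hh]
          abel
        rw [heq, E.add_mem_iff_left hd]
      simp only [this]
    · rw [henc]
      refine Finset.sum_eq_zero fun μ _ => if_neg fun hμ => hr ?_
      have h1 := (memK _).1 (hEK hμ) r
      have h2 := (memK _).1 (hrepK μ) r
      rw [dotProduct_sub, dotProduct_add, h2, zero_add, dotProduct_smul, hzh, smul_eq_mul,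
        mul_one, sub_eq_zero] at h1
      rw [h1, hdot, two]

end Quantum

/-! ### Ranks from the Gram matrix of the rows -/

section Rank

variable {R A B : Type*} [Fintype R] [Fintype A] [DecidableEq B]

/-- The sums of the coordinates of a vector over the classes `blk ⁻¹ {m}`. -/
def blockSum (blk : R → B) : (R → ZMod 2) →ₗ[ZMod 2] B → ZMod 2 :=
  LinearMap.pi fun m => ∑ r with blk r = m, LinearMap.proj r

theorem blockSum_apply (blk : R → B) (v : R → ZMod 2) (m : B) :
    blockSum blk v m = ∑ r with blk r = m, v r := by
  simp [blockSum]

theorem sum_blockSum [Fintype B] (blk : R → B) (v : R → ZMod 2) :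
    ∑ m, blockSum blk v m = ∑ r, v r := by
  simp_rw [blockSum_apply]
  exact Finset.sum_fiberwise _ _ _

/-- The rows of `M` fall into classes; every class has an odd number of rows and is a partition of
the set of columns, and the inner products of the rows are `1`, except for those of two different
rows in the same class, which are `0`. -/
structure IsResolved (M : Matrix R A (ZMod 2)) (blk : R → B) : Prop where
  dotProduct_self : ∀ r, M r ⬝ᵥ M r = 1
  dotProduct_of_eq : ∀ r r', r ≠ r' → blk r = blk r' → M r ⬝ᵥ M r' = 0
  dotProduct_of_ne : ∀ r r', blk r ≠ blk r' → M r ⬝ᵥ M r' = 1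
  sum_block : ∀ m a, ∑ r with blk r = m, M r a = 1
  card_block : ∀ m, ((Finset.univ.filter fun r => blk r = m).card : ZMod 2) = 1

namespace IsResolved

variable {M : Matrix R A (ZMod 2)} {blk : R → B}

theorem blockSum_comp (hM : IsResolved M blk) (c : B → ZMod 2) : blockSum blk (c ∘ blk) = c := by
  funext m
  rw [blockSum_apply, Finset.sum_congr rfl (g := fun _ => c m)]
  · rw [Finset.sum_const, nsmul_eq_mul, hM.card_block, one_mul]
  · intro r hr
    rw [Function.comp_apply, (Finset.mem_filter.1 hr).2]

theorem finrank_ker_blockSum [Fintype B] (hM : IsResolved M blk) :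
    Module.finrank (ZMod 2) (LinearMap.ker (blockSum blk)) + Fintype.card B = Fintype.card R := by
  have h := LinearMap.finrank_range_add_finrank_ker (blockSum blk)
  rw [LinearMap.range_eq_top.2 fun c => ⟨c ∘ blk, hM.blockSum_comp c⟩, finrank_top,
    Module.finrank_fintype_fun_eq_card, Module.finrank_fintype_fun_eq_card] at h
  omega

/-- The Gram matrix is `I + J + P` over `𝔽₂`, where `J` is the all-ones matrix and `P` marks the
pairs of rows in the same class. -/
theorem mulVec_vecMul (hM : IsResolved M blk) (v : R → ZMod 2) (r : R) :
    (M *ᵥ (v ᵥ* M)) r = v r + ∑ r', v r' + blockSum blk v (blk r) := by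
  classical
  have hG : ∀ r', M r ⬝ᵥ M r' =
      (if r = r' then 1 else 0) + 1 + if blk r' = blk r then 1 else 0 := by
    intro r'
    by_cases h : r = r'
    · subst h
      simp [hM.dotProduct_self, CharTwo.add_self_eq_zero]
    · by_cases hb : blk r = blk r'
      · rw [hM.dotProduct_of_eq r r' h hb, if_neg h, if_pos hb.symm]
        decide
      · rw [hM.dotProduct_of_ne r r' hb, if_neg h, if_neg (Ne.symm hb)]
        decide
  rw [vecMul_eq_sum, mulVec, dotProduct_sum, blockSum_apply]
  simp only [dotProduct_smul, hG, smul_eq_mul, mul_add, Finset.sum_add_distrib, mul_ite, mul_one,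
    mul_zero, Finset.sum_ite_eq, Finset.mem_univ, if_true, Finset.sum_filter]

/-- The Gram matrix fixes the coefficient vectors whose sum over each class vanishes. -/
theorem mulVec_vecMul_of_mem_ker [Fintype B] (hM : IsResolved M blk) {v : R → ZMod 2}
    (hv : v ∈ LinearMap.ker (blockSum blk)) : M *ᵥ (v ᵥ* M) = v := by
  rw [LinearMap.mem_ker] at hv
  funext r
  rw [hM.mulVec_vecMul, ← sum_blockSum blk, hv]
  simp

theorem comp_vecMul [Fintype B] (hM : IsResolved M blk) (c : B → ZMod 2) (a : A) :
    ((c ∘ blk) ᵥ* M) a = ∑ m, c m := by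
  rw [vecMul, dotProduct, ← Finset.sum_fiberwise _ blk]
  refine Finset.sum_congr rfl fun m _ => ?_
  rw [← mul_one (c m), ← hM.sum_block m a, Finset.mul_sum]
  refine Finset.sum_congr rfl fun r hr => ?_
  rw [Function.comp_apply, (Finset.mem_filter.1 hr).2]

/-- Every even sum of rows is a sum whose coefficients add up to zero in each class: full classes
may be subtracted, as an even number of them has sum zero. -/
theorem evenRowSpace_eq [Fintype B] (hM : IsResolved M blk) :
    evenRowSpace M = (LinearMap.ker (blockSum blk)).map M.vecMulLinear := by
  ext x
  rw [mem_evenRowSpace, Submodule.mem_map]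
  constructor
  · rintro ⟨v, hv, rfl⟩
    refine ⟨v - blockSum blk v ∘ blk, ?_, ?_⟩
    · rw [LinearMap.mem_ker, map_sub, hM.blockSum_comp, sub_self]
    · rw [vecMulLinear_apply, sub_vecMul]
      funext a
      rw [Pi.sub_apply, hM.comp_vecMul, sum_blockSum, hv, sub_zero]
  · rintro ⟨v, hv, rfl⟩
    refine ⟨v, ?_, rfl⟩
    rw [LinearMap.mem_ker] at hv
    rw [← sum_blockSum blk, hv]
    simp

theorem finrank_evenRowSpace [Fintype B] (hM : IsResolved M blk) :
    Module.finrank (ZMod 2) (evenRowSpace M) + Fintype.card B = Fintype.card R := by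
  rw [← hM.finrank_ker_blockSum, hM.evenRowSpace_eq,
    ← LinearMap.range_domRestrict, LinearMap.finrank_range_of_inj]
  intro v w h
  have h' := congrArg (M *ᵥ ·) h
  simp only [LinearMap.domRestrict_apply, vecMulLinear_apply] at h'
  rw [hM.mulVec_vecMul_of_mem_ker v.2, hM.mulVec_vecMul_of_mem_ker w.2] at h'
  exact Subtype.ext h'

theorem range_mulVecLin [Fintype B] [Nonempty B] (hM : IsResolved M blk) :
    LinearMap.range M.mulVecLin =
      LinearMap.ker (blockSum blk) ⊔ Submodule.span (ZMod 2) {1} := by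
  apply le_antisymm
  · rintro _ ⟨a, rfl⟩
    have h1 : blockSum blk 1 = 1 := hM.blockSum_comp 1
    have h2 : blockSum blk (M *ᵥ a) = (∑ j, a j) • 1 := by
      funext m
      simp only [blockSum_apply, mulVec, dotProduct, Pi.smul_apply, Pi.one_apply, smul_eq_mul,
        mul_one]
      rw [Finset.sum_comm]
      refine Finset.sum_congr rfl fun j _ => ?_
      rw [← Finset.sum_mul, hM.sum_block, one_mul]
    refine Submodule.mem_sup.2 ⟨M *ᵥ a - (∑ j, a j) • 1, ?_, (∑ j, a j) • 1,
      Submodule.smul_mem _ _ (Submodule.mem_span_singleton_self _), by simp⟩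
    rw [LinearMap.mem_ker, map_sub, map_smul, h1, h2, sub_self]
  · refine sup_le (fun v hv => ⟨v ᵥ* M, hM.mulVec_vecMul_of_mem_ker hv⟩) ?_
    rw [Submodule.span_singleton_le_iff_mem]
    obtain ⟨m⟩ := ‹Nonempty B›
    -- The sum of the rows in one class has inner product `1` with every row.
    refine ⟨(Pi.single m 1 ∘ blk) ᵥ* M, ?_⟩
    funext r
    rw [mulVecLin_apply, hM.mulVec_vecMul, hM.blockSum_comp, ← sum_blockSum blk,
      hM.blockSum_comp, Finset.sum_pi_single', if_pos (Finset.mem_univ _), Function.comp_apply,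
      Pi.one_apply, add_right_comm, CharTwo.add_self_eq_zero, zero_add]

theorem finrank_ker_mulVecLin [Fintype B] [Nonempty B] (hM : IsResolved M blk) :
    Module.finrank (ZMod 2) (LinearMap.ker M.mulVecLin) + Fintype.card R + 1 =
      Fintype.card A + Fintype.card B := by
  have h1 := LinearMap.finrank_range_add_finrank_ker M.mulVecLin
  have h2 := Submodule.finrank_sup_add_finrank_inf_eq (LinearMap.ker (blockSum blk))
    (Submodule.span (ZMod 2) {(1 : R → ZMod 2)})
  have h3 : blockSum blk 1 = 1 := hM.blockSum_comp 1
  have h4 : LinearMap.ker (blockSum blk) ⊓ Submodule.span (ZMod 2) {(1 : R → ZMod 2)} = ⊥ := by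
    rw [eq_bot_iff]
    rintro _ ⟨hv, hv'⟩
    obtain ⟨c, rfl⟩ := Submodule.mem_span_singleton.1 hv'
    obtain ⟨m⟩ := ‹Nonempty B›
    have hc := congrFun (LinearMap.mem_ker.1 hv) m
    rw [map_smul, h3] at hc
    have : c = 0 := by simpa using hc
    simp [this]
  have h5 : (1 : R → ZMod 2) ≠ 0 := by
    intro h
    rw [h, map_zero] at h3
    exact zero_ne_one h3
  rw [← hM.range_mulVecLin, h4, finrank_bot, finrank_span_singleton h5] at h2
  rw [Module.finrank_fintype_fun_eq_card] at h1
  have h6 := hM.finrank_ker_blockSum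
  omega

end IsResolved

end Rank

/-! ### Incidence coordinates over `ZMod p` -/

section Incidence

variable {p : ℕ}

/-- The residue class modulo `p` of an element of `{0, …, p - 1}`. -/
def residue (i : Fin p) : ZMod p := ((i : ℕ) : ZMod p)

theorem residue_injective : Function.Injective (residue : Fin p → ZMod p) := by
  intro i j h
  have := (ZMod.natCast_eq_natCast_iff' _ _ _).1 h
  rw [Nat.mod_eq_of_lt i.isLt, Nat.mod_eq_of_lt j.isLt] at this
  exact Fin.ext this

theorem residue_iterate_cycPred (a : ℕ) (i : Fin p) :
    residue (cycPred^[a] i) = residue i - a := by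
  have h1 : ∀ i : Fin p, residue (cycPred i) = residue i - 1 := by
    intro i
    have hi := i.isLt
    by_cases h : (i : ℕ) = 0
    · simp [residue, cycPred, h, Nat.cast_sub (show 1 ≤ p by omega)]
    · simp [residue, cycPred, h, Nat.cast_sub (show 1 ≤ (i : ℕ) by omega)]
  induction a generalizing i with
  | zero => simp
  | succ a ih =>
    rw [Function.iterate_succ_apply, ih, h1]
    push_cast
    ring

theorem iterate_shiftX (a : ℕ) (T : Cube p) (x y z : Fin p) :
    (shiftX^[a] T) x y z = T (cycPred^[a] x) y z := by
  induction a generalizing T with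
  | zero => rfl
  | succ a ih => rw [Function.iterate_succ_apply, ih, Function.iterate_succ_apply']; rfl

theorem iterate_shiftY (a : ℕ) (T : Cube p) (x y z : Fin p) :
    (shiftY^[a] T) x y z = T x (cycPred^[a] y) z := by
  induction a generalizing T with
  | zero => rfl
  | succ a ih => rw [Function.iterate_succ_apply, ih, Function.iterate_succ_apply']; rfl

/-- Affine coordinates `((f, y), (g, u))` of a position `(X, Y)`: with `X = i p + x` and
`Y = j p + y` they are `f = φ i`, `y`, `g = ψ j` and `u = x - y`. -/
def pointCoord (φ ψ : Fin p → Fin p) (q : Fin (p * p) × Fin (p * p)) :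
    (ZMod p × ZMod p) × ZMod p × ZMod p :=
  ((residue (φ q.1.divNat), residue q.2.modNat),
    residue (ψ q.2.divNat), residue q.1.modNat - residue q.2.modNat)

/-- Coordinates `(m, s, z)` of the layer `l = (m p + t) p + z`, where `s = ζ m t`. -/
def layerCoord (ζ : Fin p → Fin p → Fin p) (l : Fin (p * p * p)) : ZMod p × ZMod p × ZMod p :=
  (residue (blockLayer l), residue (eta ζ l.divNat), residue l.modNat)

theorem divNat_modNat_injective {m n : ℕ} {k l : Fin (m * n)} (h1 : k.divNat = l.divNat)
    (h2 : k.modNat = l.modNat) : k = l :=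
  finProdFinEquiv.symm.injective (Prod.ext h1 h2)

theorem pointCoord_bijective [NeZero p] {φ ψ : Fin p → Fin p} (hφ : Function.Injective φ)
    (hψ : Function.Injective ψ) : Function.Bijective (pointCoord φ ψ) := by
  refine (Fintype.bijective_iff_injective_and_card _).2 ⟨?_, by simp [ZMod.card]⟩
  rintro ⟨X, Y⟩ ⟨X', Y'⟩ h
  simp only [pointCoord, Prod.mk.injEq] at h
  obtain ⟨⟨h1, h2⟩, h3, h4⟩ := h
  rw [h2, sub_left_inj] at h4
  exact Prod.ext
    (divNat_modNat_injective (hφ (residue_injective h1)) (residue_injective h4))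
    (divNat_modNat_injective (hψ (residue_injective h3)) (residue_injective h2))

theorem layerCoord_bijective [NeZero p] {ζ : Fin p → Fin p → Fin p}
    (hζ : ∀ m, Function.Injective (ζ m)) : Function.Bijective (layerCoord ζ) := by
  refine (Fintype.bijective_iff_injective_and_card _).2 ⟨?_, by simp [ZMod.card, mul_assoc]⟩
  intro l l' h
  simp only [layerCoord, blockLayer, eta, Prod.mk.injEq] at h
  obtain ⟨h1, h2, h3⟩ := h
  have h1 := residue_injective h1
  rw [h1] at h2
  exact divNat_modNat_injective
    (divNat_modNat_injective h1 (hζ _ (residue_injective h2))) (residue_injective h3)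

/-- The position `((f, y), (g, u))` lies on the layer `(m, s, z)` when `(f, y)` is on the line
`y = z + m f` and `(g, u)` is on the parallel line `u = s + m g`. -/
def Incident (L : ZMod p × ZMod p × ZMod p) (P : (ZMod p × ZMod p) × ZMod p × ZMod p) : Prop :=
  P.1.2 = L.2.2 + L.1 * P.1.1 ∧ P.2.2 = L.2.1 + L.1 * P.2.1

instance (L : ZMod p × ZMod p × ZMod p) : DecidablePred (Incident L) :=
  fun _ => inferInstanceAs (Decidable (_ ∧ _))

theorem parityTensor_eq (φ ψ : Fin p → Fin p) (ζ : Fin p → Fin p → Fin p)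
    (q : Fin (p * p) × Fin (p * p)) (l : Fin (p * p * p)) :
    parityTensor φ ψ ζ q.1 q.2 l =
      if Incident (layerCoord ζ l) (pointCoord φ ψ q) then 1 else 0 := by
  rw [parityTensor, iterate_shiftX, iterate_shiftY, identityCube]
  refine if_congr ?_ rfl rfl
  rw [← residue_injective.eq_iff, ← residue_injective.eq_iff, residue_iterate_cycPred,
    residue_iterate_cycPred]
  have hm : ((l.divNat : ℕ) / p : ℕ) = (l.divNat.divNat : ℕ) := rfl
  simp only [xShift, yShift, ZMod.natCast_mod, Incident, layerCoord, pointCoord, hm, Nat.cast_add,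
    Nat.cast_mul, blockLayer]
  simp only [residue]
  constructor
  · rintro ⟨h1, h2⟩
    exact ⟨by linear_combination h2, by linear_combination h1⟩
  · rintro ⟨h1, h2⟩
    exact ⟨by linear_combination h2, by linear_combination h1⟩

theorem card_incident [NeZero p] (L : ZMod p × ZMod p × ZMod p) :
    (Finset.univ.filter fun P => Incident L P).card = p ^ 2 := by
  have : (Finset.univ : Finset (ZMod p × ZMod p)).card = p ^ 2 := by
    simp [ZMod.card, sq]
  rw [← this]
  refine Finset.card_bij' (fun P _ => (P.1.1, P.2.1))
    (fun c _ => ((c.1, L.2.2 + L.1 * c.1), c.2, L.2.1 + L.1 * c.2)) ?_ ?_ ?_ ?_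
  · simp
  · exact fun c _ => Finset.mem_filter.2 ⟨Finset.mem_univ _, rfl, rfl⟩
  · rintro ⟨⟨f, y⟩, g, u⟩ hP
    obtain ⟨h1, h2⟩ := (Finset.mem_filter.1 hP).2
    simp only at h1 h2
    rw [h1, h2]
  · simp

theorem Incident.eq_of_fst_eq {L L' : ZMod p × ZMod p × ZMod p}
    {P : (ZMod p × ZMod p) × ZMod p × ZMod p} (h : Incident L P) (h' : Incident L' P)
    (hm : L.1 = L'.1) : L = L' := by
  obtain ⟨h1, h2⟩ := h
  obtain ⟨h1', h2'⟩ := h'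
  rw [hm] at h1 h2
  exact Prod.ext hm (Prod.ext (add_right_cancel (h2.symm.trans h2'))
    (add_right_cancel (h1.symm.trans h1')))

theorem existsUnique_incident_of_fst_ne [Fact p.Prime] {L L' : ZMod p × ZMod p × ZMod p}
    (hm : L.1 ≠ L'.1) : ∃! P, Incident L P ∧ Incident L' P := by
  obtain ⟨m, s, z⟩ := L
  obtain ⟨m', s', z'⟩ := L'
  have hm' : m - m' ≠ 0 := sub_ne_zero.2 hm
  refine ⟨(((z' - z) / (m - m'), z + m * ((z' - z) / (m - m'))),
    (s' - s) / (m - m'), s + m * ((s' - s) / (m - m'))), ⟨⟨rfl, rfl⟩, ?_, ?_⟩, ?_⟩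
  · simp only
    field_simp
    ring
  · simp only
    field_simp
    ring
  · rintro ⟨⟨f, y⟩, g, u⟩ ⟨⟨h1, h2⟩, h1', h2'⟩
    simp only at h1 h2 h1' h2'
    have hf : f = (z' - z) / (m - m') := by
      rw [eq_div_iff hm']; linear_combination h1' - h1
    have hg : g = (s' - s) / (m - m') := by
      rw [eq_div_iff hm']; linear_combination h2' - h2
    rw [h1, h2, hf, hg]

end Incidence

/-! ### The parity-check matrices -/

section ParityMatrix

variable {p : ℕ} [Fact p.Prime] {φ ψ : Fin p → Fin p} {ζ : Fin p → Fin p → Fin p}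

/-- The horizontal layer `l` has a `1` at the position `q`. -/
abbrev OnLayer (φ ψ : Fin p → Fin p) (ζ : Fin p → Fin p → Fin p) (l : Fin (p * p * p))
    (q : Fin (p * p) × Fin (p * p)) : Prop :=
  Incident (layerCoord ζ l) (pointCoord φ ψ q)

omit [Fact p.Prime] in
theorem parityTensor_ne_zero_iff (q : Fin (p * p) × Fin (p * p)) (l : Fin (p * p * p)) :
    parityTensor φ ψ ζ q.1 q.2 l ≠ 0 ↔ OnLayer φ ψ ζ l q := by
  rw [parityTensor_eq]
  simp

theorem card_onLayer (hφ : Function.Injective φ) (hψ : Function.Injective ψ)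
    (l : Fin (p * p * p)) : (Finset.univ.filter fun q => OnLayer φ ψ ζ l q).card = p ^ 2 := by
  rw [← card_incident (layerCoord ζ l)]
  have hb := pointCoord_bijective hφ hψ
  refine Finset.card_bij (fun q _ => pointCoord φ ψ q) (by simp) (fun _ _ _ _ h => hb.1 h) ?_
  intro P hP
  obtain ⟨q, rfl⟩ := hb.2 P
  exact ⟨q, by simpa using hP, rfl⟩

theorem OnLayer.eq_of_blockLayer_eq (hζ : ∀ m, Function.Injective (ζ m)) {l l' : Fin (p * p * p)}
    {q : Fin (p * p) × Fin (p * p)} (h : OnLayer φ ψ ζ l q) (h' : OnLayer φ ψ ζ l' q)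
    (hb : blockLayer l = blockLayer l') : l = l' :=
  (layerCoord_bijective hζ).1 (Incident.eq_of_fst_eq h h' (congrArg residue hb))

theorem existsUnique_onLayer_of_blockLayer_ne (hφ : Function.Injective φ)
    (hψ : Function.Injective ψ) {l l' : Fin (p * p * p)} (hb : blockLayer l ≠ blockLayer l') :
    ∃! q, OnLayer φ ψ ζ l q ∧ OnLayer φ ψ ζ l' q := by
  have hc := pointCoord_bijective hφ hψ
  obtain ⟨P, hP, huniq⟩ := existsUnique_incident_of_fst_ne
    (L := layerCoord ζ l) (L' := layerCoord ζ l') (residue_injective.ne hb)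
  obtain ⟨q, rfl⟩ := hc.2 P
  exact ⟨q, hP, fun q' hq' => hc.1 (huniq _ hq')⟩

theorem exists_onLayer_of_blockLayer (hζ : ∀ m, Function.Injective (ζ m)) (m : Fin p)
    (q : Fin (p * p) × Fin (p * p)) : ∃ l, blockLayer l = m ∧ OnLayer φ ψ ζ l q := by
  set P := pointCoord φ ψ q with hP
  obtain ⟨l, hl⟩ := (layerCoord_bijective hζ).2
    (residue m, P.2.2 - residue m * P.2.1, P.1.2 - residue m * P.1.1)
  refine ⟨l, residue_injective (congrArg Prod.fst hl), ?_⟩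
  rw [OnLayer, hl, ← hP]
  simp [Incident]

omit [Fact p.Prime] in
theorem parityMatrix_dotProduct {B B' : Finset (Fin p)} (r : Layers B) (r' : Layers B') :
    parityMatrix φ ψ ζ B r ⬝ᵥ parityMatrix φ ψ ζ B' r' =
      ((Finset.univ.filter fun q => OnLayer φ ψ ζ r.1 q ∧ OnLayer φ ψ ζ r'.1 q).card : ZMod 2) := by
  rw [Finset.card_filter, dotProduct]
  push_cast
  refine Finset.sum_congr rfl fun q _ => ?_
  simp only [parityMatrix, parityTensor_eq, OnLayer, ← ite_and, mul_ite, mul_one, mul_zero]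
  congr 1
  rw [and_comm]

theorem parityMatrix_dotProduct_of_ne (hφ : Function.Injective φ) (hψ : Function.Injective ψ)
    {B B' : Finset (Fin p)} (r : Layers B) (r' : Layers B')
    (h : blockLayer r.1 ≠ blockLayer r'.1) :
    parityMatrix φ ψ ζ B r ⬝ᵥ parityMatrix φ ψ ζ B' r' = 1 := by
  obtain ⟨q, hq, huniq⟩ := existsUnique_onLayer_of_blockLayer_ne (ζ := ζ) hφ hψ h
  have : (Finset.univ.filter fun q => OnLayer φ ψ ζ r.1 q ∧ OnLayer φ ψ ζ r'.1 q) = {q} := by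
    ext q'
    simp only [Finset.mem_filter, Finset.mem_univ, true_and, Finset.mem_singleton]
    exact ⟨huniq q', fun h => h ▸ hq⟩
  rw [parityMatrix_dotProduct, this]
  simp

/-- The block-layer of a row of the parity-check matrix. -/
def rowBlock {B : Finset (Fin p)} (r : Layers B) : B := ⟨blockLayer r.1, r.2⟩

omit [Fact p.Prime] in
theorem card_rowBlock {B : Finset (Fin p)} (m : B) :
    (Finset.univ.filter fun r : Layers B => rowBlock r = m).card = p ^ 2 := by
  have : (Finset.univ : Finset (Fin p × Fin p)).card = p ^ 2 := by simp [sq]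
  rw [← this]
  refine Finset.card_bij (fun r _ => (r.1.divNat.modNat, r.1.modNat)) (by simp) ?_ ?_
  · intro r hr r' hr' h
    rw [Prod.mk.injEq] at h
    have hb : rowBlock r = rowBlock r' :=
      (Finset.mem_filter.1 hr).2.trans (Finset.mem_filter.1 hr').2.symm
    exact Subtype.ext (divNat_modNat_injective
      (divNat_modNat_injective (congrArg Subtype.val hb) h.1) h.2)
  · rintro ⟨t, z⟩ -
    have h1 := fun c : Fin p × Fin p => finProdFinEquiv.symm_apply_apply c
    have h2 := fun c : Fin (p * p) × Fin p => finProdFinEquiv.symm_apply_apply c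
    simp only [finProdFinEquiv_symm_apply, Prod.ext_iff] at h1 h2
    have hb : blockLayer (finProdFinEquiv (finProdFinEquiv (m.1, t), z)) = m := by
      rw [blockLayer, (h2 _).1, (h1 _).1]
    refine ⟨⟨finProdFinEquiv (finProdFinEquiv (m.1, t), z), by rw [hb]; exact m.2⟩, ?_, ?_⟩
    · exact Finset.mem_filter.2 ⟨Finset.mem_univ _, Subtype.ext hb⟩
    · simp only [(h2 _).1, (h2 _).2, (h1 _).2]

omit [Fact p.Prime] in
theorem card_layers (B : Finset (Fin p)) : Fintype.card (Layers B) = B.card * p ^ 2 := by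
  rw [← Finset.card_univ,
    Finset.card_eq_sum_card_fiberwise (f := rowBlock) (t := Finset.univ) (by simp)]
  simp only [card_rowBlock, Finset.sum_const, Finset.card_univ, Fintype.card_coe, smul_eq_mul]

theorem isResolved_parityMatrix (hodd : Odd p) (hφ : Function.Injective φ)
    (hψ : Function.Injective ψ) (hζ : ∀ m, Function.Injective (ζ m)) (B : Finset (Fin p)) :
    IsResolved (parityMatrix φ ψ ζ B) (rowBlock (B := B)) where
  dotProduct_self r := by
    rw [parityMatrix_dotProduct]
    simp only [and_self]
    rw [card_onLayer hφ hψ]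
    exact hodd.pow.natCast_zmod_two
  dotProduct_of_eq r r' hne hb := by
    rw [parityMatrix_dotProduct, Finset.filter_false_of_mem]
    · simp
    · rintro q - ⟨h, h'⟩
      exact hne (Subtype.ext (h.eq_of_blockLayer_eq hζ h' (congrArg Subtype.val hb)))
  dotProduct_of_ne r r' hb :=
    parityMatrix_dotProduct_of_ne hφ hψ r r' fun h => hb (Subtype.ext h)
  sum_block m q := by
    obtain ⟨l, hl, hq⟩ := exists_onLayer_of_blockLayer (φ := φ) (ψ := ψ) hζ m.1 q
    let r₀ : Layers B := ⟨l, by rw [hl]; exact m.2⟩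
    have hr₀ : rowBlock r₀ = m := Subtype.ext hl
    rw [Finset.sum_eq_single r₀]
    · simp [r₀, parityMatrix, parityTensor_eq, hq]
    · intro r hr hne
      rw [parityMatrix, parityTensor_eq, if_neg]
      intro hr'
      refine hne (Subtype.ext (OnLayer.eq_of_blockLayer_eq (φ := φ) (ψ := ψ) hζ hr' hq ?_))
      exact congrArg Subtype.val ((Finset.mem_filter.1 hr).2.trans hr₀.symm)
    · intro h
      exact absurd (Finset.mem_filter.2 ⟨Finset.mem_univ r₀, hr₀⟩) h
  card_block m := by
    rw [card_rowBlock]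
    exact hodd.pow.natCast_zmod_two

theorem card_layers_onLayer (hζ : ∀ m, Function.Injective (ζ m)) (B : Finset (Fin p))
    (q : Fin (p * p) × Fin (p * p)) :
    {r : Layers B | OnLayer φ ψ ζ r.1 q}.ncard = B.card := by
  rw [← Set.ncard_coe_finset]
  refine Set.ncard_congr (fun r _ => blockLayer r.1) (fun r _ => r.2) ?_ ?_
  · intro r r' hr hr' h
    exact Subtype.ext (hr.eq_of_blockLayer_eq hζ hr' h)
  · intro m hm
    obtain ⟨l, rfl, hq⟩ := exists_onLayer_of_blockLayer (φ := φ) (ψ := ψ) hζ m q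
    exact ⟨⟨l, hm⟩, hq, rfl⟩

end ParityMatrix

/-! ### Tanner graphs -/

section Tanner

variable {R V : Type*}

/-- A bipartite graph in which two different vertices on the left have at most one common neighbour
has girth greater than four. -/
theorem four_lt_egirth_of_bipartite {G : SimpleGraph (R ⊕ V)}
    (hR : ∀ r r', ¬ G.Adj (.inl r) (.inl r')) (hV : ∀ v v', ¬ G.Adj (.inr v) (.inr v'))
    (h : ∀ r r' v v', r ≠ r' → G.Adj (.inl r) (.inr v) → G.Adj (.inl r') (.inr v) →
      G.Adj (.inl r) (.inr v') → G.Adj (.inl r') (.inr v') → v = v') : 4 < G.egirth := by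
  have h5 : (5 : ℕ∞) ≤ G.egirth := by
    rw [SimpleGraph.le_egirth]
    intro a w hw
    have h3 := hw.three_le_length
    have hnodup := hw.support_nodup
    by_contra hlt
    have hlt : w.length < 5 := by exact_mod_cast not_le.1 hlt
    match w, h3, hnodup, hlt with
    | .cons (v := b) h₁ (.cons (v := c) h₂ (.cons h₃ .nil)), _, _, _ =>
      rcases a with a | a <;> rcases b with b | b <;> rcases c with c | c <;>
        first
          | exact hR _ _ h₁ | exact hV _ _ h₁ | exact hR _ _ h₂ | exact hV _ _ h₂
          | exact hR _ _ h₃ | exact hV _ _ h₃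
    | .cons (v := b) h₁ (.cons (v := c) h₂ (.cons (v := d) h₃ (.cons h₄ .nil))), _, hnodup, _ =>
      simp only [SimpleGraph.Walk.support_cons, SimpleGraph.Walk.support_nil, List.tail_cons,
        List.nodup_cons, List.mem_cons, not_or, List.not_mem_nil, not_false_eq_true] at hnodup
      obtain ⟨⟨-, hbd, -⟩, ⟨-, hca, -⟩, -⟩ := hnodup
      rcases a with a | a <;> rcases b with b | b <;>
        first | exact hR _ _ h₁ | exact hV _ _ h₁ | skip
      · rcases c with c | c
        swap
        · exact hV _ _ h₂
        rcases d with d | d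
        · exact hR _ _ h₃
        exact hbd (congrArg _ (h a c b d (fun e => hca (by rw [e])) h₁ h₂.symm h₄.symm h₃))
      · rcases c with c | c
        · exact hR _ _ h₂
        rcases d with d | d
        swap
        · exact hV _ _ h₃
        exact hca (congrArg _ (h b d c a (fun e => hbd (by rw [e])) h₂ h₃.symm h₁.symm h₄))
    | .cons _ (.cons _ (.cons _ (.cons _ (.cons _ _)))), _, _, hlt =>
      simp only [SimpleGraph.Walk.length_cons] at hlt
      omega
  exact lt_of_lt_of_le (by norm_num) h5

theorem tannerGraph_adj_inl_inr (M : Matrix R V (ZMod 2)) (r : R) (v : V) :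
    (tannerGraph M).Adj (.inl r) (.inr v) ↔ M r v ≠ 0 := by
  simp [tannerGraph]

theorem not_tannerGraph_adj_inl_inl (M : Matrix R V (ZMod 2)) (r r' : R) :
    ¬ (tannerGraph M).Adj (.inl r) (.inl r') := by
  simp [tannerGraph]

theorem not_tannerGraph_adj_inr_inr (M : Matrix R V (ZMod 2)) (v v' : V) :
    ¬ (tannerGraph M).Adj (.inr v) (.inr v') := by
  simp [tannerGraph]

variable {R₁ R₂ A : Type*} [Fintype A] {c : ℕ}

theorem unassistedTannerGraph_adj (S : EACSS R₁ R₂ A c) (r : R₁ ⊕ R₂) (q : A) :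
    S.unassistedTannerGraph.Adj (.inl r) (.inr q) ↔ fromRows S.xCheck S.zCheck r q ≠ 0 := by
  rw [EACSS.unassistedTannerGraph, SimpleGraph.comap_adj]
  refine (tannerGraph_adj_inl_inr _ _ _).trans ?_
  rcases r with r | r <;> rfl

theorem not_unassistedTannerGraph_adj_inl_inl (S : EACSS R₁ R₂ A c) (r r' : R₁ ⊕ R₂) :
    ¬ S.unassistedTannerGraph.Adj (.inl r) (.inl r') :=
  not_tannerGraph_adj_inl_inl _ r r'

theorem not_unassistedTannerGraph_adj_inr_inr (S : EACSS R₁ R₂ A c) (q q' : A) :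
    ¬ S.unassistedTannerGraph.Adj (.inr q) (.inr q') :=
  not_tannerGraph_adj_inr_inr _ (Sum.inl q) (Sum.inl q')

theorem neighborSet_inl (S : EACSS R₁ R₂ A c) (r : R₁ ⊕ R₂) :
    S.unassistedTannerGraph.neighborSet (.inl r) =
      Sum.inr '' {q | fromRows S.xCheck S.zCheck r q ≠ 0} := by
  ext (r' | q)
  · simpa using not_unassistedTannerGraph_adj_inl_inl S r r'
  · simpa using unassistedTannerGraph_adj S r q

theorem neighborSet_inr (S : EACSS R₁ R₂ A c) (q : A) :
    S.unassistedTannerGraph.neighborSet (.inr q) =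
      Sum.inl '' {r | fromRows S.xCheck S.zCheck r q ≠ 0} := by
  ext (r | q')
  · rw [SimpleGraph.mem_neighborSet, SimpleGraph.adj_comm]
    simpa using unassistedTannerGraph_adj S r q
  · simpa using not_unassistedTannerGraph_adj_inr_inr S q q'

/-- Two generators that share at most one channel qubit lie on no cycle of length four. -/
theorem four_lt_egirth_unassistedTannerGraph (S : EACSS R₁ R₂ A c)
    (h : ∀ r r' q q', r ≠ r' → fromRows S.xCheck S.zCheck r q ≠ 0 →
      fromRows S.xCheck S.zCheck r' q ≠ 0 → fromRows S.xCheck S.zCheck r q' ≠ 0 →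
      fromRows S.xCheck S.zCheck r' q' ≠ 0 → q = q') :
    4 < S.unassistedTannerGraph.egirth := by
  refine four_lt_egirth_of_bipartite (not_unassistedTannerGraph_adj_inl_inl S)
    (not_unassistedTannerGraph_adj_inr_inr S) ?_
  simpa only [unassistedTannerGraph_adj] using h

end Tanner

/-! ### The entanglement-assisted code -/

section Code

variable {p : ℕ} [Fact p.Prime] {φ ψ : Fin p → Fin p} {ζ : Fin p → Fin p → Fin p}

/-- The one-ebit code of the two parity-check matrices, with every generator acting on the ebit. -/
def ebitCode (hφ : Function.Injective φ) (hψ : Function.Injective ψ)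
    (ζ : Fin p → Fin p → Fin p) {B₁ B₂ : Finset (Fin p)} (hB : Disjoint B₁ B₂) :
    EACSS (Layers B₁) (Layers B₂) (Fin (p * p) × Fin (p * p)) 1 where
  xCheck := parityMatrix φ ψ ζ B₁
  zCheck := parityMatrix φ ψ ζ B₂
  xEbit := Matrix.of fun _ _ => 1
  zEbit := Matrix.of fun _ _ => 1
  commute := by
    ext r r'
    have h : parityMatrix φ ψ ζ B₁ r ⬝ᵥ parityMatrix φ ψ ζ B₂ r' = 1 :=
      parityMatrix_dotProduct_of_ne hφ hψ r r' fun h =>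
        Finset.disjoint_left.1 hB r.2 (h ▸ r'.2)
    rw [dotProduct] at h
    rw [Matrix.add_apply, Matrix.mul_apply, Matrix.mul_apply]
    simp only [transpose_apply, of_apply, h, mul_one, Finset.univ_unique, Finset.sum_const,
      Finset.card_singleton, one_smul, CharTwo.add_self_eq_zero, Matrix.zero_apply]

theorem fromRows_ebitCode_ne_zero_iff (hφ : Function.Injective φ) (hψ : Function.Injective ψ)
    {B₁ B₂ : Finset (Fin p)} (hB : Disjoint B₁ B₂) (r : Layers B₁ ⊕ Layers B₂)
    (q : Fin (p * p) × Fin (p * p)) :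
    fromRows (ebitCode hφ hψ ζ hB).xCheck (ebitCode hφ hψ ζ hB).zCheck r q ≠ 0 ↔
      OnLayer φ ψ ζ (Sum.elim Subtype.val Subtype.val r) q := by
  rcases r with r | r <;> exact parityTensor_ne_zero_iff q r.1

omit [Fact p.Prime] in
theorem layers_injective {B₁ B₂ : Finset (Fin p)} (hB : Disjoint B₁ B₂) :
    Function.Injective (Sum.elim Subtype.val Subtype.val :
      Layers B₁ ⊕ Layers B₂ → Fin (p * p * p)) :=
  Subtype.val_injective.sumElim Subtype.val_injective fun r r' h =>
    Finset.disjoint_left.1 hB r.2 (h ▸ r'.2)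

theorem layers_nonempty {B : Finset (Fin p)} (hB : B.Nonempty) : Nonempty (Layers B) := by
  rw [← Fintype.card_pos_iff, card_layers]
  exact Nat.mul_pos hB.card_pos (pow_pos (Fact.out : p.Prime).pos 2)

theorem isEACode_ebitCode (hodd : Odd p) (hφ : Function.Injective φ)
    (hψ : Function.Injective ψ) (hζ : ∀ m, Function.Injective (ζ m)) {B₁ B₂ : Finset (Fin p)}
    (hB₁ : B₁.Nonempty) (hB₂ : B₂.Nonempty) (hB : Disjoint B₁ B₂) :
    ∃ k : ℕ, (k : ℤ) = (p : ℤ) ^ 4 - 2 * (p : ℤ) ^ 2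
        - ((p : ℤ) ^ 2 - 1) * ((B₁.card : ℤ) + (B₂.card : ℤ) - 2) + 1 ∧
      IsEACode (p ^ 4) k 1 (ebitCode hφ hψ ζ hB).codeSpace := by
  have := layers_nonempty hB₁
  have := layers_nonempty hB₂
  have := hB₂.to_subtype
  set S := ebitCode hφ hψ ζ hB with hS
  have hE : Module.finrank (ZMod 2) (evenRowSpace S.xCheck) + Fintype.card B₁ = _ :=
    (isResolved_parityMatrix hodd hφ hψ hζ B₁).finrank_evenRowSpace
  have hK : Module.finrank (ZMod 2) (LinearMap.ker S.zCheck.mulVecLin) + _ + 1 =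
      _ + Fintype.card B₂ :=
    (isResolved_parityMatrix hodd hφ hψ hζ B₂).finrank_ker_mulVecLin
  have hcard : Fintype.card (Fin (p * p) × Fin (p * p)) = p ^ 4 := by simp; ring
  rw [card_layers, Fintype.card_coe] at hE hK
  rw [hcard] at hK
  have hle := Submodule.finrank_mono (evenRowSpace_le_ker S fun _ _ => rfl)
  obtain ⟨k, hk⟩ := Nat.exists_eq_add_of_le hle
  refine ⟨k, ?_, hcard ▸ isEACode_codeSpace S (fun _ _ => rfl) (fun _ _ => rfl) hk.symm⟩
  zify at hE hK hk
  linear_combination hK - hE - hk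

theorem ncard_neighborSet_inl_ebitCode (hφ : Function.Injective φ) (hψ : Function.Injective ψ)
    {B₁ B₂ : Finset (Fin p)} (hB : Disjoint B₁ B₂) (r : Layers B₁ ⊕ Layers B₂) :
    ((ebitCode hφ hψ ζ hB).unassistedTannerGraph.neighborSet (.inl r)).ncard = p ^ 2 := by
  rw [neighborSet_inl, Set.ncard_image_of_injective _ Sum.inr_injective]
  simp only [fromRows_ebitCode_ne_zero_iff]
  rw [← card_onLayer (ζ := ζ) hφ hψ (Sum.elim Subtype.val Subtype.val r), ← Set.ncard_coe_finset,
    Finset.coe_filter_univ]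

theorem ncard_neighborSet_inr_ebitCode (hφ : Function.Injective φ) (hψ : Function.Injective ψ)
    (hζ : ∀ m, Function.Injective (ζ m)) {B₁ B₂ : Finset (Fin p)} (hB : Disjoint B₁ B₂)
    (q : Fin (p * p) × Fin (p * p)) :
    ((ebitCode hφ hψ ζ hB).unassistedTannerGraph.neighborSet (.inr q)).ncard =
      B₁.card + B₂.card := by
  rw [neighborSet_inr, Set.ncard_image_of_injective _ Sum.inl_injective]
  simp only [fromRows_ebitCode_ne_zero_iff]
  have hsplit : {r : Layers B₁ ⊕ Layers B₂ |
      OnLayer φ ψ ζ (Sum.elim Subtype.val Subtype.val r) q} =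
      Sum.inl '' {r | OnLayer φ ψ ζ r.1 q} ∪ Sum.inr '' {r | OnLayer φ ψ ζ r.1 q} := by
    ext (r | r) <;> simp
  rw [hsplit, Set.ncard_union_eq (Set.isCompl_range_inl_range_inr.disjoint.mono
    (Set.image_subset_range _ _) (Set.image_subset_range _ _)),
    Set.ncard_image_of_injective _ Sum.inl_injective,
    Set.ncard_image_of_injective _ Sum.inr_injective, card_layers_onLayer hζ,
    card_layers_onLayer hζ]

theorem four_lt_egirth_ebitCode (hφ : Function.Injective φ) (hψ : Function.Injective ψ)
    (hζ : ∀ m, Function.Injective (ζ m)) {B₁ B₂ : Finset (Fin p)} (hB : Disjoint B₁ B₂) :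
    4 < (ebitCode hφ hψ ζ hB).unassistedTannerGraph.egirth := by
  refine four_lt_egirth_unassistedTannerGraph _ fun r r' q q' hne h1 h2 h3 h4 => ?_
  rw [fromRows_ebitCode_ne_zero_iff] at h1 h2 h3 h4
  have hb : blockLayer (Sum.elim Subtype.val Subtype.val r : Fin (p * p * p)) ≠
      blockLayer (Sum.elim Subtype.val Subtype.val r') := fun hb =>
    hne (layers_injective hB (h1.eq_of_blockLayer_eq hζ h2 hb))
  exact (existsUnique_onLayer_of_blockLayer_ne hφ hψ hb).unique ⟨h1, h2⟩ ⟨h3, h4⟩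

end Code

end EAQLDPC

theorem mainTheorem6 (p : ℕ) (hp : p.Prime) (hp_odd : Odd p)
    (φ ψ : Fin p → Fin p) (hφ : Function.Bijective φ) (hψ : Function.Bijective ψ)
    (ζ : Fin p → Fin p → Fin p) (hζ : ∀ m, Function.Bijective (ζ m))
    (w₁ w₂ : ℕ) (hw₁ : 1 ≤ w₁) (hw₂ : 1 ≤ w₂)
    (B₁ B₂ : Finset (Fin p)) (hB₁ : B₁.card = w₁) (hB₂ : B₂.card = w₂)
    (hB : Disjoint B₁ B₂) :
    ∃ S : EAQLDPC.EACSS (EAQLDPC.Layers B₁) (EAQLDPC.Layers B₂)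
        (Fin (p * p) × Fin (p * p)) 1,
      S.xCheck = EAQLDPC.parityMatrix φ ψ ζ B₁ ∧
      S.zCheck = EAQLDPC.parityMatrix φ ψ ζ B₂ ∧
      (∃ k : ℕ,
        (k : ℤ) = (p : ℤ) ^ 4 - 2 * (p : ℤ) ^ 2
          - ((p : ℤ) ^ 2 - 1) * ((w₁ : ℤ) + (w₂ : ℤ) - 2) + 1 ∧
        EAQLDPC.IsEACode (p ^ 4) k 1 S.codeSpace) ∧
      (∀ r, (S.unassistedTannerGraph.neighborSet (Sum.inl r)).ncard = p ^ 2) ∧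
      (∀ q, (S.unassistedTannerGraph.neighborSet (Sum.inr q)).ncard = w₁ + w₂) ∧
      4 < S.unassistedTannerGraph.egirth := by
  have : Fact p.Prime := ⟨hp⟩
  subst hB₁ hB₂
  have hζ' := fun m => (hζ m).1
  exact ⟨EAQLDPC.ebitCode hφ.1 hψ.1 ζ hB, rfl, rfl,
    EAQLDPC.isEACode_ebitCode hp_odd hφ.1 hψ.1 hζ' (Finset.card_pos.1 hw₁)
      (Finset.card_pos.1 hw₂) hB,
    EAQLDPC.ncard_neighborSet_inl_ebitCode hφ.1 hψ.1 hB,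
    EAQLDPC.ncard_neighborSet_inr_ebitCode hφ.1 hψ.1 hζ' hB,
    EAQLDPC.four_lt_egirth_ebitCode hφ.1 hψ.1 hζ' hB⟩
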